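/- For a finite connected simple graph $G$ with vertex set $V(G)$ and an integer $k\ge 0$, the $k$-th Elser number is $$\mathsf{els}_k(G)=(-1)^{|V(G)|+1}\sum_{N}(-1)^{|E(N)|}\,|V(N)|^k,$$ where $N$ runs over all nuclei of $G$, i.e. all connected (nonempty) subgraphs $N\subseteq G$ such that every edge of $G$ has at least one endpoint in $V(N)$. A cut-vertex of a graph is a vertex whose deletion increases the number of connected components. A graph is called 2-connected if it is connected, has at least two vertices and has no cut-vertex (so $K_2$ is 2-connected); a block of $G$ is a maximal 2-connected subgraph. The block–cutpoint tree of $G$ has the blocks and the cut-vertices of $G$ as its nodes, a block being joined to each cut-vertex it contains. Let $G$ be a finite connected simple graph with at least two vertices. (a) If $G$ is 2-connected, then $\mathsf{els}_0(G)<0$, $\mathsf{els}_1(G)=0$, and $\mathsf{els}_k(G)>0$ for all $k\ge 2$. (b) Otherwise, let $\ell$ be the number of leaves of the block–cutpoint tree of $G$. Then $\ell\ge 2$, $\ell$ equals the number of blocks of $G$ that contain exactly one cut-vertex of $G$, and for every integer $k\ge 0$ we have $\mathsf{els}_k(G)\neq 0$ if and only if $k\ge\ell$. -/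

import Mathlib

namespace Elser

/-- A nucleus of `G`: a connected (in particular nonempty) subgraph, not necessarily induced or
spanning, whose vertex set is a vertex cover of `G`. -/
def IsNucleus {V : Type*} (G : SimpleGraph V) (N : G.Subgraph) : Prop :=
  N.Connected ∧ G.IsVertexCover N.verts

open Classical in
/-- The `k`-th Elser number
`els_k(G) = (-1)^(|V(G)|+1) * ∑_N (-1)^|E(N)| |V(N)|^k`, summed over all nuclei `N` of `G`. -/
noncomputable def els {V : Type*} [Fintype V] (G : SimpleGraph V) (k : ℕ) : ℤ :=
  (-1) ^ (Fintype.card V + 1) *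
    ∑ N ∈ (Finset.univ : Finset G.Subgraph).filter (fun N => IsNucleus G N),
      (-1) ^ N.edgeSet.ncard * (N.verts.ncard : ℤ) ^ k

/-- `x` is a cut-vertex of the (finite) graph `G` if `G - x` has more connected components
than `G`. -/
def IsCutVertex {V : Type*} (G : SimpleGraph V) (x : V) : Prop :=
  Nat.card G.ConnectedComponent < Nat.card (G.induce ({x}ᶜ : Set V)).ConnectedComponent

/-- 2-connected graphs, where `K₂` counts as 2-connected: connected graphs with at least two
vertices and no cut-vertex. -/
def IsTwoConnected {V : Type*} (G : SimpleGraph V) : Prop :=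
  G.Connected ∧ Nontrivial V ∧ ∀ x : V, ¬ IsCutVertex G x

/-- A block (2-connected component) of `G`: a maximal 2-connected subgraph. -/
def IsBlock {V : Type*} (G : SimpleGraph V) (B : G.Subgraph) : Prop :=
  Maximal (fun H : G.Subgraph => IsTwoConnected H.coe) B

/-- The block–cutpoint graph of `G`: its nodes are the blocks and the cut-vertices of `G`, and
a block is joined to each cut-vertex that it contains. (It is a tree when `G` is connected and has
at least two vertices.) -/
def blockCutpointGraph {V : Type*} (G : SimpleGraph V) :
    SimpleGraph ({B : G.Subgraph // IsBlock G B} ⊕ {x : V // IsCutVertex G x}) where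
  Adj a b := match a, b with
    | Sum.inl B, Sum.inr x => x.1 ∈ B.1.verts
    | Sum.inr x, Sum.inl B => x.1 ∈ B.1.verts
    | _, _ => False
  symm := by
    constructor
    rintro (a | a) (b | b) h <;> exact h
  loopless := by
    constructor
    rintro (a | a) h <;> exact h

/-- The number of leaves (nodes of degree one) of the block–cutpoint graph of `G`. -/
noncomputable def numLeaves {V : Type*} (G : SimpleGraph V) : ℕ :=
  {a | ((blockCutpointGraph G).neighborSet a).ncard = 1}.ncard

/-- The number of leaf blocks: blocks of `G` that contain exactly one cut-vertex of `G`. -/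
noncomputable def numLeafBlocks {V : Type*} (G : SimpleGraph V) : ℕ :=
  {B : G.Subgraph | IsBlock G B ∧ {x ∈ B.verts | IsCutVertex G x}.ncard = 1}.ncard

end Elser

namespace Elser

/-! Expand `|V(N)|^k` as the number of maps `f : Fin k → V` with range in `V(N)`. Then `els G k` is
the sum over `f` of `coverSum G univ (range f)`, the signed count of nuclei whose vertex set
contains the range (`els_eq_sum_coverSum`).

Splitting covers by whether they contain `v ∈ U`, and rearranging, gives `coverSum W U = coverSum W
(U \ {v}) + coverSum (W \ {v}) (U \ {v} ∪ N(v))`, which has no minus sign. The recursion ends at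
singletons `U = {u}`: there the value is 1 if `W = {u}`, and 0 for larger connected `W`, because
grouping all edge sets by the component of `u` makes them cancel. So `coverSum` is nonnegative for
connected `W` and nonempty `U`. `MeetsAllParts` obeys the same recursion with "or" for "+", hence
says exactly when the value is positive (`coverSum_nonneg_and_pos_iff`).

For `k ≥ 1` it remains to find the least size of a set meeting all parts. It is 2 for a 2-connected
graph. Otherwise it is the number of leaf blocks: the non-cut-vertices of a leaf block form a part
that must be hit, and every part at a cut-vertex contains those of some leaf block. For `k = 0`, one
deletion step turns the empty `U` into a neighbourhood (`els_zero_eq`). -/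

/-- `C` is a union of connected components of the graph that `H` induces on `W`. -/
def AdjClosed {V : Type*} (H : SimpleGraph V) (W C : Set V) : Prop :=
  C ⊆ W ∧ ∀ a ∈ C, ∀ b ∈ W, H.Adj a b → b ∈ C

/-- The graph that `H` induces on `W` is connected. -/
def ConnectedOn {V : Type*} (H : SimpleGraph V) (W : Set V) : Prop :=
  W.Nonempty ∧ ∀ C : Set V, C.Nonempty → AdjClosed H W C → C = W

/-- Deleting any single vertex from the graph that `H` induces on `W` leaves no component that
misses `U`. -/
def MeetsAllParts {V : Type*} (H : SimpleGraph V) (W U : Set V) : Prop :=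
  ∀ x ∈ W, ∀ C : Set V, C.Nonempty → AdjClosed H (W \ {x}) C → (C ∩ U).Nonempty

/-! ### Connectedness through closed sets, with no change of vertex type -/

section AdjClosed

variable {V : Type*} {H : SimpleGraph V} {W C : Set V}

lemma AdjClosed.compl (h : AdjClosed H W C) : AdjClosed H W (W \ C) :=
  ⟨Set.sdiff_subset, fun a ha b hb hab => ⟨hb, fun hbC => ha.2 (h.2 b hbC a ha.1 hab.symm)⟩⟩

lemma AdjClosed.restrict {S : Set V} (h : AdjClosed H W C) (hS : S ⊆ W) :
    AdjClosed H S (C ∩ S) :=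
  ⟨Set.inter_subset_right, fun a ha b hb hab => ⟨h.2 a ha.1 b (hS hb) hab, hb⟩⟩

lemma ConnectedOn.subset_of_adjClosed {S : Set V} (hS : ConnectedOn H S) (hC : AdjClosed H W C)
    (hSW : S ⊆ W) (hne : (C ∩ S).Nonempty) : S ⊆ C :=
  Set.inter_eq_right.1 (hS.2 _ hne (hC.restrict hSW))

/-- To check connectedness it suffices to look at the unions of components that avoid a given
vertex. -/
lemma connectedOn_of_forall_notMem {x : V} (hx : x ∈ W)
    (h : ∀ C : Set V, AdjClosed H W C → x ∉ C → C = ∅) : ConnectedOn H W := by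
  refine ⟨⟨x, hx⟩, fun C hC hCl => ?_⟩
  have hxC : x ∈ C := by
    by_contra hxC
    exact hC.ne_empty (h C hCl hxC)
  have := h _ hCl.compl (fun h => h.2 hxC)
  exact hCl.1.antisymm (Set.sdiff_eq_empty.1 this)

lemma connectedOn_singleton (x : V) : ConnectedOn H {x} :=
  connectedOn_of_forall_notMem rfl fun C hC hx => by
    ext y
    refine ⟨fun hy => ?_, fun hy => hy.elim⟩
    have : y = x := hC.1 hy
    exact hx (this ▸ hy)

lemma ConnectedOn.mono {H' : SimpleGraph V} (hle : ∀ a ∈ W, ∀ b ∈ W, H.Adj a b → H'.Adj a b)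
    (h : ConnectedOn H W) : ConnectedOn H' W :=
  ⟨h.1, fun C hC hCl => h.2 C hC
    ⟨hCl.1, fun a ha b hb hab => hCl.2 a ha b hb (hle a (hCl.1 ha) b hb hab)⟩⟩

lemma exists_component (H : SimpleGraph V) {w : V} (hw : w ∈ W) :
    ∃ C, AdjClosed H W C ∧ w ∈ C ∧ ConnectedOn H C := by
  have key : AdjClosed H W (⋂₀ {C | AdjClosed H W C ∧ w ∈ C}) :=
    ⟨fun x hx => hx W ⟨⟨subset_rfl, fun _ _ _ hb _ => hb⟩, hw⟩,
      fun a ha b hb hab C hC => hC.1.2 a (ha C hC) b hb hab⟩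
  have hwm : w ∈ ⋂₀ {C | AdjClosed H W C ∧ w ∈ C} := fun C hC => hC.2
  refine ⟨_, key, hwm, connectedOn_of_forall_notMem hwm fun F hF hwF => ?_⟩
  have hF' : AdjClosed H W F := ⟨hF.1.trans key.1,
    fun a ha b hb hab => hF.2 a ha b (key.2 a (hF.1 ha) b hb hab) hab⟩
  -- The complement of `F` is again closed and contains `w`, so it contains the intersection.
  have hsub : ⋂₀ {C | AdjClosed H W C ∧ w ∈ C} ⊆ W \ F :=
    Set.sInter_subset_of_mem ⟨hF'.compl, hw, hwF⟩
  exact Set.eq_empty_of_forall_notMem fun y hy => (hsub (hF.1 hy)).2 hy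

/-- A set that is closed and connected is determined by any of its points. -/
lemma AdjClosed.eq_of_connectedOn {D : Set V} (hC : AdjClosed H W C) (hD : AdjClosed H W D)
    (hC' : ConnectedOn H C) (hD' : ConnectedOn H D) {u : V} (huC : u ∈ C) (huD : u ∈ D) : C = D :=
  (hC'.subset_of_adjClosed hD hC.1 ⟨u, huD, huC⟩).antisymm
    (hD'.subset_of_adjClosed hC hD.1 ⟨u, huC, huD⟩)

lemma connected_induce_iff (H : SimpleGraph V) (W : Set V) :
    (H.induce W).Connected ↔ ConnectedOn H W := by
  constructor
  · intro h
    obtain ⟨x⟩ := h.nonempty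
    refine connectedOn_of_forall_notMem x.2 fun C hC hx => ?_
    by_contra hne
    obtain ⟨y, hy⟩ := Set.nonempty_iff_ne_empty.2 hne
    obtain ⟨p⟩ := h.preconnected ⟨y, hC.1 hy⟩ x
    obtain ⟨d, -, h1, h2⟩ := p.exists_boundary_dart {z | z.1 ∈ C} hy hx
    exact h2 (hC.2 _ h1 _ d.snd.2 d.adj)
  · intro h
    obtain ⟨x, hx⟩ := h.1
    rw [SimpleGraph.connected_iff_exists_forall_reachable]
    refine ⟨⟨x, hx⟩, fun w => ?_⟩
    have := h.2 {y | ∃ hy : y ∈ W, (H.induce W).Reachable ⟨x, hx⟩ ⟨y, hy⟩}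
      ⟨x, hx, SimpleGraph.Reachable.refl _⟩
      ⟨fun y hy => hy.1, fun a ⟨ha, ha'⟩ b hb hab =>
        ⟨hb, ha'.trans (SimpleGraph.Adj.reachable (by exact hab))⟩⟩
    have hw := this.ge w.2
    exact hw.2

lemma connected_iff_connectedOn (H : SimpleGraph V) : H.Connected ↔ ConnectedOn H Set.univ := by
  rw [← connected_induce_iff]
  exact (SimpleGraph.induceUnivIso H).connected_iff.symm

lemma subgraph_connected_iff {G : SimpleGraph V} (N : G.Subgraph) :
    N.Connected ↔ ConnectedOn N.spanningCoe N.verts := by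
  rw [← connected_induce_iff, SimpleGraph.Subgraph.connected_iff']
  exact Iff.rfl

end AdjClosed

/-! ### The recursion for sets meeting all parts -/

section MeetsAllParts

variable {V : Type*} {G : SimpleGraph V} {W U : Set V}

lemma MeetsAllParts.mono {U' : Set V} (h : MeetsAllParts G W U) (hU : U ⊆ U') :
    MeetsAllParts G W U' :=
  fun x hx C hC hCl => (h x hx C hC hCl).mono (Set.inter_subset_inter_right _ hU)

lemma not_meetsAllParts_singleton {u : V} (hW : (W \ {u}).Nonempty) (hu : u ∈ W) :
    ¬ MeetsAllParts G W {u} := by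
  intro h
  obtain ⟨y, hy, hyu⟩ := h u hu (W \ {u}) hW ⟨subset_rfl, fun _ _ _ hb _ => hb⟩
  exact hy.2 hyu

/-- After deletion of `v` every union of components meets the neighbours of `v`. -/
lemma ConnectedOn.inter_neighborSet_nonempty {v : V} (hW : ConnectedOn G W) (hv : v ∈ W)
    {C : Set V} (hC : C.Nonempty) (hCl : AdjClosed G (W \ {v}) C) :
    (C ∩ (G.neighborSet v ∩ W)).Nonempty := by
  by_contra hne
  have : C = W := hW.2 C hC ⟨fun x hx => (hCl.1 hx).1, fun a ha b hb hab => by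
    by_cases hbv : b = v
    · subst hbv
      exact (hne ⟨a, ha, hab.symm, (hCl.1 ha).1⟩).elim
    · exact hCl.2 a ha b ⟨hb, hbv⟩ hab⟩
  exact (hCl.1 (this ▸ hv : v ∈ C)).2 rfl

/-- Deletion of a vertex `v` of `U`, its neighbours being added to `U`. -/
lemma meetsAllParts_iff_delete {v : V} (hW : ConnectedOn G W) (hv : v ∈ U) (hU : U ⊆ W)
    (hne : (U \ {v}).Nonempty) :
    MeetsAllParts G W U ↔ MeetsAllParts G W (U \ {v}) ∨
      (ConnectedOn G (W \ {v}) ∧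
        MeetsAllParts G (W \ {v}) (U \ {v} ∪ (G.neighborSet v ∩ W))) := by
  constructor
  · intro h
    by_contra! hcon
    obtain ⟨h1, h2⟩ := hcon
    unfold MeetsAllParts at h1
    push Not at h1
    obtain ⟨x, hx, C₀, hC₀, hC₀l, hC₀U⟩ := h1
    have hvC₀ : v ∈ C₀ := by
      obtain ⟨y, hy, hyU⟩ := h x hx C₀ hC₀ hC₀l
      by_contra hvC
      exact (Set.eq_empty_iff_forall_notMem.1 hC₀U y) ⟨hy, hyU, fun e => hvC (e ▸ hy)⟩
    have hxv : x ≠ v := fun e => (hC₀l.1 hvC₀).2 e.symm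
    -- A part `D` of `W \ {v}` avoiding `x` would make `D \ C₀` closed in all of `W`: a neighbour of
    -- `v` in `D` is absorbed by `C₀`, as `v ∈ C₀`.
    have hconn : ConnectedOn G (W \ {v}) := by
      refine connectedOn_of_forall_notMem (x := x) ⟨hx, hxv⟩ fun D hD hxD => ?_
      by_contra hDne
      obtain ⟨y, hyD, hyU⟩ := h v (hU hv) D (Set.nonempty_iff_ne_empty.2 hDne) hD
      have hyC : y ∉ C₀ := fun hyC =>
        (Set.eq_empty_iff_forall_notMem.1 hC₀U y) ⟨hyC, hyU, (hD.1 hyD).2⟩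
      have : D \ C₀ = W := hW.2 _ ⟨y, hyD, hyC⟩ ⟨fun z hz => (hD.1 hz.1).1,
        fun a ha b hb hab => by
          have hax : a ∈ W \ {x} := ⟨(hD.1 ha.1).1, fun e => hxD (e ▸ ha.1)⟩
          have hbC : b ∉ C₀ := fun hbC => ha.2 (hC₀l.2 b hbC a hax hab.symm)
          have hbv : b ≠ v := fun e => hbC (e ▸ hvC₀)
          exact ⟨hD.2 a ha.1 b ⟨hb, hbv⟩ hab, hbC⟩⟩
      exact (this ▸ hU hv : v ∈ D \ C₀).2 hvC₀
    refine h2 hconn fun y hy C hC hCl => ?_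
    by_contra hmiss
    -- A part missing the neighbours of `v` stays closed when `v` is put back.
    have hCl' : AdjClosed G (W \ {y}) C := ⟨fun z hz => ⟨(hCl.1 hz).1.1, (hCl.1 hz).2⟩,
      fun a ha b hb hab => by
        by_cases hbv : b = v
        · subst hbv
          exact (hmiss ⟨a, ha, Or.inr ⟨hab.symm, (hCl.1 ha).1.1⟩⟩).elim
        · exact hCl.2 a ha b ⟨⟨hb.1, hbv⟩, hb.2⟩ hab⟩
    obtain ⟨z, hz, hzU⟩ := h y hy.1 C hC hCl'
    exact hmiss ⟨z, hz, Or.inl ⟨hzU, (hCl.1 hz).1.2⟩⟩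
  · rintro (h | ⟨hconn, h⟩)
    · exact h.mono Set.sdiff_subset
    · intro x hx C hC hCl
      by_contra hmiss
      by_cases hxv : x = v
      · subst hxv
        obtain ⟨y, hy⟩ := hne
        have := hconn.2 C hC hCl
        exact hmiss ⟨y, this ▸ ⟨hU hy.1, hy.2⟩, hy.1⟩
      · have hvC : v ∉ C := fun hvC => hmiss ⟨v, hvC, hv⟩
        obtain ⟨z, hz, hzU⟩ := h x ⟨hx, hxv⟩ C hC
          ⟨fun z hz => ⟨⟨(hCl.1 hz).1, fun e => hvC (e ▸ hz)⟩, (hCl.1 hz).2⟩,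
            fun a ha b hb hab => hCl.2 a ha b ⟨hb.1.1, hb.2⟩ hab⟩
        rcases hzU with hzU | hzU
        · exact hmiss ⟨z, hz, hzU.1⟩
        · exact hvC (hCl.2 z hz v ⟨hU hv, fun e => hxv e.symm⟩ hzU.1.symm)

end MeetsAllParts

/-! ### Signed counts of connected subgraphs -/

/-- `S` is a vertex cover of the graph that `G` induces on `W`. -/
def CoversOn {V : Type*} (G : SimpleGraph V) (W S : Set V) : Prop :=
  ∀ a ∈ W, ∀ b ∈ W, G.Adj a b → a ∈ S ∨ b ∈ S

open Classical in
/-- The signed number of connected subgraphs of `G` with vertex set `S`. -/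
noncomputable def weight {V : Type*} [Fintype V] (G : SimpleGraph V) (S : Set V) : ℤ :=
  ∑ N ∈ (Finset.univ : Finset G.Subgraph).filter (fun N => N.Connected ∧ N.verts = S),
    (-1) ^ N.edgeSet.ncard

section Weight

variable {V : Type*} {G : SimpleGraph V}

lemma connectedOn_congr {H H' : SimpleGraph V} {S : Set V}
    (h : ∀ a ∈ S, ∀ b ∈ S, H.Adj a b ↔ H'.Adj a b) : ConnectedOn H S ↔ ConnectedOn H' S :=
  ⟨fun hS => hS.mono fun a ha b hb => (h a ha b hb).1,
    fun hS => hS.mono fun a ha b hb => (h a ha b hb).2⟩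

lemma adjClosed_congr {H H' : SimpleGraph V} {W S : Set V}
    (h : ∀ a ∈ S, ∀ b, H.Adj a b ↔ H'.Adj a b) : AdjClosed H W S ↔ AdjClosed H' W S :=
  and_congr_right fun _ => forall₂_congr fun a ha => forall₂_congr fun b _ => by rw [h a ha b]

/-- The edge sets with a prescribed component `S` containing `u`. -/
def IsComponentAt (W : Set V) (u : V) (S : Set V) (A : Finset (Sym2 V)) : Prop :=
  u ∈ S ∧ AdjClosed (SimpleGraph.fromEdgeSet (A : Set (Sym2 V))) W S ∧
    ConnectedOn (SimpleGraph.fromEdgeSet (A : Set (Sym2 V))) S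

lemma existsUnique_isComponentAt {W : Set V} {u : V} (hu : u ∈ W) (A : Finset (Sym2 V)) :
    ∃! S, IsComponentAt W u S A := by
  obtain ⟨C, h1, h2, h3⟩ := exists_component (SimpleGraph.fromEdgeSet (A : Set (Sym2 V))) hu
  exact ⟨C, ⟨h2, h1, h3⟩, fun D ⟨h2', h1', h3'⟩ => h1'.eq_of_connectedOn h1 h3' h3 h2' h2⟩

variable [Fintype V]

lemma weight_eq_zero {S : Set V} (hS : ¬ ConnectedOn G S) : weight G S = 0 := by
  classical
  unfold weight
  rw [Finset.sum_eq_zero]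
  intro N hN
  obtain ⟨hconn, rfl⟩ := (Finset.mem_filter.1 hN).2
  exact (hS (((subgraph_connected_iff N).1 hconn).mono fun a _ b _ h => N.adj_sub h)).elim

open Classical in
/-- The edges of `G` inside `W`. -/
noncomputable def edgesIn (G : SimpleGraph V) (W : Set V) : Finset (Sym2 V) :=
  Finset.univ.filter fun e => e ∈ G.edgeSet ∧ ∀ x ∈ e, x ∈ W

lemma mk_mem_edgesIn {W : Set V} {a b : V} :
    s(a, b) ∈ edgesIn G W ↔ G.Adj a b ∧ a ∈ W ∧ b ∈ W := by
  classical
  simp [edgesIn]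

-- Toggling an uncovered edge changes the sign but not the component `S`, since neither endpoint
-- lies in `S`.
open Classical in
lemma sum_isComponentAt_eq_zero {W S : Set V} {u : V} (hS : ¬ CoversOn G W S) :
    ∑ A ∈ (edgesIn G W).powerset.filter (IsComponentAt W u S), (-1 : ℤ) ^ A.card = 0 := by
  unfold CoversOn at hS
  push Not at hS
  obtain ⟨c, hc, d, hd, hcd, hcS, hdS⟩ := hS
  have hmem : s(c, d) ∈ edgesIn G W := mk_mem_edgesIn.2 ⟨hcd, hc, hd⟩
  set e := s(c, d) with he
  have hcong : ∀ A B : Finset (Sym2 V), (∀ f, f ≠ e → (f ∈ A ↔ f ∈ B)) →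
      IsComponentAt W u S A → IsComponentAt W u S B := by
    rintro A B hAB ⟨h1, h2, h3⟩
    have key : ∀ a ∈ S, ∀ b, (SimpleGraph.fromEdgeSet (A : Set (Sym2 V))).Adj a b ↔
        (SimpleGraph.fromEdgeSet (B : Set (Sym2 V))).Adj a b := by
      intro a ha b
      have hne : s(a, b) ≠ e := by
        intro h
        rw [he, Sym2.eq_iff] at h
        rcases h with ⟨rfl, rfl⟩ | ⟨rfl, rfl⟩
        · exact hcS ha
        · exact hdS ha
      simp only [SimpleGraph.fromEdgeSet_adj, Finset.mem_coe, hAB _ hne]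
    exact ⟨h1, (adjClosed_congr key).1 h2, (connectedOn_congr fun a ha b _ => key a ha b).1 h3⟩
  refine Finset.sum_involution (fun A _ => if e ∈ A then A.erase e else insert e A) ?_ ?_ ?_ ?_
  · intro A _
    by_cases heA : e ∈ A
    · have := Finset.card_erase_add_one heA
      simp only [heA, if_true]
      rw [← this, pow_succ]
      ring
    · simp only [heA, if_false]
      rw [Finset.card_insert_of_notMem heA, pow_succ]
      ring
  · intro A _ _
    by_cases heA : e ∈ A
    · simp only [heA, if_true]
      exact fun h => Finset.notMem_erase e A (h.symm ▸ heA)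
    · simp only [heA, if_false]
      exact fun h => heA (h ▸ Finset.mem_insert_self e A)
  · intro A hA
    rw [Finset.mem_filter, Finset.mem_powerset] at hA ⊢
    by_cases heA : e ∈ A
    · simp only [heA, if_true]
      exact ⟨(Finset.erase_subset _ _).trans hA.1,
        hcong A _ (fun f hf => by simp [hf]) hA.2⟩
    · simp only [heA, if_false]
      exact ⟨Finset.insert_subset hmem hA.1, hcong A _ (fun f hf => by simp [hf]) hA.2⟩
  · intro A _
    by_cases heA : e ∈ A <;> simp [heA]

-- As `S` is a cover and a component, every edge of `A` has one endpoint, hence both, in `S`; so `A`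
-- is exactly the edge set of a connected subgraph on `S`.
open Classical in
lemma sum_isComponentAt_eq_weight {W S : Set V} {u : V} (hu : u ∈ S) (hSW : S ⊆ W)
    (hS : CoversOn G W S) :
    ∑ A ∈ (edgesIn G W).powerset.filter (IsComponentAt W u S), (-1 : ℤ) ^ A.card =
      weight G S := by
  unfold weight
  symm
  have hadj : ∀ (N : G.Subgraph) (a b : V),
      (SimpleGraph.fromEdgeSet (N.edgeSet.toFinset : Set (Sym2 V))).Adj a b ↔ N.Adj a b := by
    intro N a b
    simp only [SimpleGraph.fromEdgeSet_adj, Set.coe_toFinset, SimpleGraph.Subgraph.mem_edgeSet]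
    exact ⟨fun h => h.1, fun h => ⟨h, h.ne⟩⟩
  refine Finset.sum_bij (fun N _ => N.edgeSet.toFinset) ?_ ?_ ?_ ?_
  · intro N hN
    obtain ⟨hconn, rfl⟩ := (Finset.mem_filter.1 hN).2
    rw [Finset.mem_filter, Finset.mem_powerset]
    refine ⟨fun e => ?_, hu, ⟨hSW, fun a ha b _ hab => ?_⟩, ?_⟩
    · induction e with
      | h a b =>
        intro hab
        rw [Set.mem_toFinset, SimpleGraph.Subgraph.mem_edgeSet] at hab
        exact mk_mem_edgesIn.2 ⟨N.adj_sub hab, hSW (N.edge_vert hab), hSW (N.edge_vert hab.symm)⟩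
    · exact N.edge_vert ((hadj N a b).1 hab).symm
    · exact (connectedOn_congr fun a _ b _ => hadj N a b).2 ((subgraph_connected_iff N).1 hconn)
  · intro N hN M hM hNM
    have h1 := (Finset.mem_filter.1 hN).2.2
    have h2 := (Finset.mem_filter.1 hM).2.2
    refine SimpleGraph.Subgraph.ext (h1.trans h2.symm) ?_
    ext a b
    rw [← hadj N, ← hadj M]
    rw [show N.edgeSet.toFinset = M.edgeSet.toFinset from hNM]
  · intro A hA
    obtain ⟨hAE, -, hcl, hconn⟩ := Finset.mem_filter.1 hA
    rw [Finset.mem_powerset] at hAE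
    have hAS : ∀ a b, s(a, b) ∈ A → a ∈ S ∧ b ∈ S ∧ G.Adj a b := by
      intro a b hab
      obtain ⟨h1, h2, h3⟩ := mk_mem_edgesIn.1 (hAE hab)
      have hA' : (SimpleGraph.fromEdgeSet (A : Set (Sym2 V))).Adj a b := by
        simpa using ⟨hab, h1.ne⟩
      rcases hS a h2 b h3 h1 with h | h
      · exact ⟨h, hcl.2 a h b h3 hA', h1⟩
      · exact ⟨hcl.2 b h a h2 hA'.symm, h, h1⟩
    let N : G.Subgraph :=
      { verts := S
        Adj := fun a b => s(a, b) ∈ A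
        adj_sub := fun h => (hAS _ _ h).2.2
        edge_vert := fun h => (hAS _ _ h).1
        symm := ⟨fun a b h => by rwa [Sym2.eq_swap]⟩ }
    have hNA : N.edgeSet.toFinset = A := by
      ext e
      induction e with
      | h a b => simp [N]
    refine ⟨N, Finset.mem_filter.2 ⟨Finset.mem_univ _, ?_, rfl⟩, hNA⟩
    rw [subgraph_connected_iff]
    refine (connectedOn_congr fun a _ b _ => ?_).1 hconn
    rw [← hNA, hadj N]
    rfl
  · intro N _
    rw [Set.ncard_eq_toFinset_card']

open Classical in
/-- If `W` is not edgeless, the weights of the vertex covers of `W` through a given vertex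
cancel. -/
lemma sum_weight_eq_zero {W : Set V} {u a b : V} (hu : u ∈ W) (ha : a ∈ W) (hb : b ∈ W)
    (hab : G.Adj a b) :
    ∑ S ∈ (Finset.univ : Finset (Set V)).filter
      (fun S => {u} ⊆ S ∧ S ⊆ W ∧ CoversOn G W S), weight G S = 0 := by
  have h0 : ∑ A ∈ (edgesIn G W).powerset, (-1 : ℤ) ^ A.card = 0 :=
    Finset.sum_powerset_neg_one_pow_card_of_nonempty ⟨s(a, b), mk_mem_edgesIn.2 ⟨hab, ha, hb⟩⟩
  rw [← h0, Finset.sum_filter]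
  -- Each edge set is counted once, at the component of `u` that it determines.
  have h1 : ∀ A ∈ (edgesIn G W).powerset, (-1 : ℤ) ^ A.card =
      ∑ S : Set V, if IsComponentAt W u S A then (-1 : ℤ) ^ A.card else 0 := by
    intro A _
    obtain ⟨S, hS, huniq⟩ := existsUnique_isComponentAt hu A
    rw [Finset.sum_eq_single S, if_pos hS]
    · exact fun T _ hT => if_neg fun h => hT (huniq T h)
    · exact fun h => (h (Finset.mem_univ _)).elim
  rw [Finset.sum_congr rfl h1, Finset.sum_comm]
  refine Finset.sum_congr rfl fun S _ => ?_
  rw [← Finset.sum_filter]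
  split_ifs with h
  · exact (sum_isComponentAt_eq_weight (h.1 rfl) h.2.1 h.2.2).symm
  · by_cases hc : CoversOn G W S
    · rw [Finset.sum_eq_zero]
      intro A hA
      obtain ⟨h1, h2, -⟩ := (Finset.mem_filter.1 hA).2
      exact (h ⟨Set.singleton_subset_iff.2 h1, h2.1, hc⟩).elim
    · exact (sum_isComponentAt_eq_zero hc).symm

lemma weight_singleton (u : V) : weight G {u} = 1 := by
  classical
  have hE : edgesIn G {u} = ∅ := by
    ext e
    induction e with
    | h a b =>
      rw [mk_mem_edgesIn]
      simp only [Set.mem_singleton_iff, Finset.notMem_empty, iff_false]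
      rintro ⟨h, rfl, rfl⟩
      exact h.ne rfl
  rw [← sum_isComponentAt_eq_weight (W := {u}) (S := {u}) rfl subset_rfl
    (fun a ha _ _ _ => Or.inl ha), hE]
  have : IsComponentAt {u} u {u} ∅ :=
    ⟨rfl, ⟨subset_rfl, fun _ _ _ hb _ => hb⟩, connectedOn_singleton u⟩
  rw [Finset.powerset_empty, Finset.filter_singleton, if_pos this]
  simp

end Weight

/-! ### Positivity of the cover sums and of the Elser numbers -/

open Classical in
/-- The signed sum of the weights of the vertex covers `S` of `W` with `U ⊆ S`. -/
noncomputable def coverSum {V : Type*} [Fintype V] (G : SimpleGraph V) (W U : Set V) : ℤ :=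
  (-1) ^ (W.ncard + 1) * ∑ S ∈ (Finset.univ : Finset (Set V)).filter
    (fun S => U ⊆ S ∧ S ⊆ W ∧ CoversOn G W S), weight G S

section CoverSum

variable {V : Type*} {G : SimpleGraph V} {W U : Set V}

lemma ConnectedOn.meets_union_neighborSet {v : V} (hW : ConnectedOn G W) (hv : v ∈ W)
    (C : Set V) (hC : C.Nonempty) (hCl : AdjClosed G (W \ {v}) C) :
    (C ∩ (U ∪ (G.neighborSet v ∩ W))).Nonempty :=
  (hW.inter_neighborSet_nonempty hv hC hCl).mono
    (Set.inter_subset_inter_right _ Set.subset_union_right)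

variable [Fintype V]

/-- A cover omitting `v` must contain all neighbours of `v`, and is then just a cover of `W \ {v}`
containing them. The minus sign comes from the drop in `|W|`. -/
lemma coverSum_delete {v : V} (hv : v ∈ W) (hvU : v ∉ U) :
    coverSum G W U = coverSum G W (insert v U) -
      coverSum G (W \ {v}) (U ∪ (G.neighborSet v ∩ W)) := by
  classical
  have hcard : (W \ {v}).ncard + 1 = W.ncard := Set.ncard_sdiff_singleton_add_one hv
  unfold coverSum
  rw [hcard, pow_succ, mul_assoc, mul_assoc, ← mul_sub]
  congr 1
  rw [← Finset.sum_filter_add_sum_filter_not _ (fun S : Set V => v ∈ S),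
    Finset.filter_filter, Finset.filter_filter]
  have h1 : (Finset.univ : Finset (Set V)).filter
      (fun S => (U ⊆ S ∧ S ⊆ W ∧ CoversOn G W S) ∧ v ∈ S) = Finset.univ.filter
      (fun S => insert v U ⊆ S ∧ S ⊆ W ∧ CoversOn G W S) := by
    refine Finset.filter_congr fun S _ => ?_
    rw [Set.insert_subset_iff]
    tauto
  have h2 : (Finset.univ : Finset (Set V)).filter
      (fun S => (U ⊆ S ∧ S ⊆ W ∧ CoversOn G W S) ∧ v ∉ S) = Finset.univ.filter
      (fun S => U ∪ (G.neighborSet v ∩ W) ⊆ S ∧ S ⊆ W \ {v} ∧ CoversOn G (W \ {v}) S) := by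
    refine Finset.filter_congr fun S _ => ?_
    rw [Set.union_subset_iff]
    constructor
    · rintro ⟨⟨hU, hS, hc⟩, hvS⟩
      exact ⟨⟨hU, fun x hx => (hc v hv x hx.2 hx.1).resolve_left hvS⟩,
        fun x hx => ⟨hS hx, fun e => hvS (e ▸ hx)⟩, fun a ha b hb => hc a ha.1 b hb.1⟩
    · rintro ⟨⟨hU, hN⟩, hS, hc⟩
      refine ⟨⟨hU, fun x hx => (hS hx).1, fun a ha b hb hab => ?_⟩, fun h => (hS h).2 rfl⟩
      by_cases hav : a = v
      · subst hav
        exact Or.inr (hN ⟨hab, hb⟩)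
      by_cases hbv : b = v
      · subst hbv
        exact Or.inl (hN ⟨hab.symm, ha⟩)
      exact hc a ⟨ha, hav⟩ b ⟨hb, hbv⟩ hab
  rw [h1, h2]
  ring

/-- A set containing `U` has points on both sides of a separation of `W`, so it carries no connected
subgraph. -/
lemma coverSum_eq_zero_of_not_connectedOn (hW : ¬ ConnectedOn G W) (hne : W.Nonempty)
    (hU : ∀ C : Set V, C.Nonempty → AdjClosed G W C → (C ∩ U).Nonempty) :
    coverSum G W U = 0 := by
  classical
  unfold coverSum
  rw [Finset.sum_eq_zero, mul_zero]
  intro S hS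
  obtain ⟨hUS, hSW, -⟩ := (Finset.mem_filter.1 hS).2
  refine weight_eq_zero fun hconn => hW ⟨hne, fun C hC hCl => ?_⟩
  by_contra hCW
  have hE : (W \ C).Nonempty := by
    rw [Set.nonempty_iff_ne_empty]
    exact fun h => hCW (hCl.1.antisymm (Set.sdiff_eq_empty.1 h))
  obtain ⟨x, hx, hxU⟩ := hU C hC hCl
  obtain ⟨y, hy, hyU⟩ := hU _ hE hCl.compl
  exact hy.2 (hconn.subset_of_adjClosed hCl hSW ⟨x, hx, hUS hxU⟩ (hUS hyU))

lemma coverSum_singleton {u : V} (hu : u ∈ W) (hW : ConnectedOn G W)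
    (hne : (W \ {u}).Nonempty) : coverSum G W {u} = 0 := by
  unfold coverSum
  obtain ⟨y, -, hy⟩ := hW.inter_neighborSet_nonempty hu hne
    ⟨subset_rfl, fun _ _ _ hb _ => hb⟩
  rw [sum_weight_eq_zero hu hu hy.2 hy.1, mul_zero]

lemma coverSum_self_singleton (u : V) : coverSum G {u} {u} = 1 := by
  classical
  unfold coverSum
  have : (Finset.univ : Finset (Set V)).filter
      (fun S => {u} ⊆ S ∧ S ⊆ {u} ∧ CoversOn G {u} S) = {{u}} := by
    ext S
    simp only [Finset.mem_filter, Finset.mem_univ, true_and, Finset.mem_singleton]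
    constructor
    · exact fun h => h.2.1.antisymm h.1
    · rintro rfl
      exact ⟨subset_rfl, subset_rfl, fun a ha _ _ _ => Or.inl ha⟩
  rw [this, Finset.sum_singleton, weight_singleton, Set.ncard_singleton]
  norm_num

/-- Induction on `|W|`, then on `|U|`, along the deletion recursion read as a sum of two nonnegative
terms. -/
theorem coverSum_nonneg_and_pos_iff (hW : ConnectedOn G W) (hU : U ⊆ W) (hne : U.Nonempty) :
    0 ≤ coverSum G W U ∧ (0 < coverSum G W U ↔ MeetsAllParts G W U) := by
  induction hn : W.ncard using Nat.strong_induction_on generalizing W U with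
  | _ n ihW =>
  induction hm : U.ncard using Nat.strong_induction_on generalizing U with
  | _ m ihU =>
    obtain ⟨v, hv⟩ := hne
    have hvW := hU hv
    have hWcard : (W \ {v}).ncard + 1 = W.ncard := Set.ncard_sdiff_singleton_add_one hvW
    have hUcard : (U \ {v}).ncard + 1 = U.ncard := Set.ncard_sdiff_singleton_add_one hv
    rcases (U \ {v}).eq_empty_or_nonempty with hUv | hUv
    · obtain rfl : U = {v} :=
        (Set.sdiff_eq_empty.1 hUv).antisymm (Set.singleton_subset_iff.2 hv)
      rcases (W \ {v}).eq_empty_or_nonempty with hWv | hWv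
      · obtain rfl : W = {v} := (Set.sdiff_eq_empty.1 hWv).antisymm hU
        rw [coverSum_self_singleton]
        refine ⟨zero_le_one, iff_of_true one_pos fun x hx C hC hCl => ?_⟩
        obtain ⟨y, hy⟩ := hC
        exact ((hCl.1 hy).2 ((hCl.1 hy).1.trans hx.symm)).elim
      · rw [coverSum_singleton hvW hW hWv]
        exact ⟨le_rfl, iff_of_false (lt_irrefl _) (not_meetsAllParts_singleton hWv hvW)⟩
    · have hrec := coverSum_delete (G := G) (U := U \ {v}) hvW
        (fun h => h.2 rfl)
      rw [Set.insert_sdiff_singleton, Set.insert_eq_of_mem hv] at hrec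
      obtain ⟨h1, h1'⟩ := ihU _ (by omega) (Set.sdiff_subset.trans hU) hUv rfl
      set U'' := U \ {v} ∪ (G.neighborSet v ∩ W) with hU''
      have hsub : U'' ⊆ W \ {v} := by
        rintro x (hx | hx)
        · exact ⟨hU hx.1, hx.2⟩
        · exact ⟨hx.2, fun e => hx.1.ne e.symm⟩
      -- If `W \ {v}` is disconnected the term is zero, because each part contains a neighbour of
      -- `v`.
      have h2 : 0 ≤ coverSum G (W \ {v}) U'' ∧ (0 < coverSum G (W \ {v}) U'' ↔
          ConnectedOn G (W \ {v}) ∧ MeetsAllParts G (W \ {v}) U'') := by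
        by_cases hc : ConnectedOn G (W \ {v})
        · obtain ⟨h, h'⟩ := ihW _ (by omega) hc hsub (hUv.mono Set.subset_union_left) rfl
          exact ⟨h, h'.trans (and_iff_right hc).symm⟩
        · rw [coverSum_eq_zero_of_not_connectedOn hc (hUv.mono (Set.sdiff_subset_sdiff_left hU))
            (hW.meets_union_neighborSet hvW)]
          exact ⟨le_rfl, iff_of_false (lt_irrefl _) fun h => hc h.1⟩
      rw [meetsAllParts_iff_delete hW hv hU hUv, ← h1', ← h2.2]
      have := h2.1
      omega

open Classical in
lemma sum_nuclei_eq (k : ℕ) :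
    ∑ N ∈ (Finset.univ : Finset G.Subgraph).filter (fun N => IsNucleus G N),
      (-1 : ℤ) ^ N.edgeSet.ncard * (N.verts.ncard : ℤ) ^ k =
    ∑ S ∈ (Finset.univ : Finset (Set V)).filter (fun S => CoversOn G Set.univ S),
      weight G S * (S.ncard : ℤ) ^ k := by
  have hc : ∀ S : Set V, CoversOn G Set.univ S ↔ G.IsVertexCover S := fun S =>
    ⟨fun h a b => h a trivial b trivial, fun h a _ b _ hab => h hab⟩
  rw [← Finset.sum_fiberwise_of_maps_to
    (g := fun N : G.Subgraph => N.verts)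
    (t := (Finset.univ : Finset (Set V)).filter (fun S => CoversOn G Set.univ S))]
  · refine Finset.sum_congr rfl fun S hS => ?_
    rw [weight, Finset.sum_mul, Finset.filter_filter]
    refine Finset.sum_congr (Finset.filter_congr fun N _ => ?_) fun N hN => ?_
    · constructor
      · exact fun h => ⟨h.1.1, h.2⟩
      · rintro ⟨h, rfl⟩
        exact ⟨⟨h, (hc _).1 (Finset.mem_filter.1 hS).2⟩, rfl⟩
    · rw [(Finset.mem_filter.1 hN).2.2]
  · intro N hN
    exact Finset.mem_filter.2 ⟨Finset.mem_univ _, (hc _).2 (Finset.mem_filter.1 hN).2.2⟩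

lemma ncard_pow_eq_sum (S : Set V) (k : ℕ) [∀ f : Fin k → V, Decidable (Set.range f ⊆ S)] :
    (S.ncard : ℤ) ^ k = ∑ f : Fin k → V, if Set.range f ⊆ S then 1 else 0 := by
  classical
  rw [← Finset.sum_filter, Finset.sum_const, nsmul_eq_mul, mul_one]
  have : (Finset.univ : Finset (Fin k → V)).filter (fun f => Set.range f ⊆ S) =
      Fintype.piFinset fun _ => S.toFinset := by
    ext f
    simp [Set.range_subset_iff]
  rw [this, Fintype.card_piFinset_const, Set.ncard_eq_toFinset_card']
  push_cast
  rfl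

theorem els_eq_sum_coverSum (k : ℕ) :
    els G k = ∑ f : Fin k → V, coverSum G Set.univ (Set.range f) := by
  classical
  unfold els coverSum
  rw [sum_nuclei_eq, Set.ncard_univ, Nat.card_eq_fintype_card, ← Finset.mul_sum]
  congr 1
  simp_rw [ncard_pow_eq_sum, Finset.mul_sum]
  rw [Finset.sum_comm]
  refine Finset.sum_congr rfl fun f _ => ?_
  simp_rw [mul_ite, mul_one, mul_zero]
  rw [← Finset.sum_filter, Finset.filter_filter]
  refine Finset.sum_congr (Finset.filter_congr fun S _ => ?_) fun _ _ => rfl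
  simp [and_comm]

/-- For `k > 0`, positivity of Elser numbers is governed by the smallest set that meets
all parts. -/
theorem els_nonneg_and_pos_iff (hG : ConnectedOn G Set.univ) {k : ℕ} (hk : k ≠ 0) :
    0 ≤ els G k ∧ (0 < els G k ↔ ∃ U : Set V, U.ncard ≤ k ∧ MeetsAllParts G Set.univ U) := by
  have : NeZero k := ⟨hk⟩
  have key : ∀ f : Fin k → V, 0 ≤ coverSum G Set.univ (Set.range f) ∧
      (0 < coverSum G Set.univ (Set.range f) ↔ MeetsAllParts G Set.univ (Set.range f)) :=
    fun f => coverSum_nonneg_and_pos_iff hG (Set.subset_univ _) (Set.range_nonempty f)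
  rw [els_eq_sum_coverSum]
  refine ⟨Finset.sum_nonneg fun f _ => (key f).1, ?_⟩
  rw [Finset.sum_pos_iff_of_nonneg fun f _ => (key f).1]
  constructor
  · rintro ⟨f, -, hf⟩
    refine ⟨Set.range f, ?_, (key f).2.1 hf⟩
    have := Set.ncard_image_le (f := f) (s := Set.univ)
    rwa [Set.image_univ, Set.ncard_univ, Nat.card_eq_fintype_card, Fintype.card_fin] at this
  · rintro ⟨U, hUk, hU⟩
    obtain ⟨x, -⟩ := hG.1
    rcases U.eq_empty_or_nonempty with rfl | hne
    -- Ranges are nonempty as `k ≠ 0`, so an empty `U` is enlarged to a point.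
    · exact ⟨fun _ => x, Finset.mem_univ _, (key _).2.2 (hU.mono (Set.empty_subset _))⟩
    · have : Nonempty U := hne.to_subtype
      obtain ⟨g, hg⟩ : ∃ g : Fin k → U, Function.Surjective g := by
        have hc : Nat.card U ≤ k := hUk
        have e := Finite.equivFin U
        obtain ⟨f⟩ : Nonempty (Fin (Nat.card U) ↪ Fin k) := ⟨Fin.castLEEmb hc⟩
        exact ⟨_, (e.symm.surjective).comp (Function.invFun_surjective f.injective)⟩
      refine ⟨fun i => g i, Finset.mem_univ _, (key _).2.2 (hU.mono fun y hy => ?_)⟩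
      obtain ⟨i, hi⟩ := hg ⟨y, hy⟩
      exact ⟨i, congrArg Subtype.val hi⟩

lemma els_zero_eq (hG : ConnectedOn G Set.univ) [Nontrivial V] (u : V) :
    els G 0 = - coverSum G (Set.univ \ {u}) (G.neighborSet u) := by
  rw [els_eq_sum_coverSum, Fintype.sum_unique, Set.range_eq_empty,
    coverSum_delete (Set.mem_univ u) (Set.notMem_empty u), insert_empty_eq,
    coverSum_singleton (Set.mem_univ u) hG, Set.empty_union, Set.inter_univ, zero_sub]
  obtain ⟨y, hy⟩ := exists_ne u
  exact ⟨y, trivial, hy⟩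

end CoverSum

/-! ### Cut-vertices and blocks as statements about vertex sets -/

/-- The graph that `H` induces on `S` is 2-connected. -/
def Biconnected {V : Type*} (H : SimpleGraph V) (S : Set V) : Prop :=
  S.Nontrivial ∧ ConnectedOn H S ∧ ∀ x ∈ S, ConnectedOn H (S \ {x})

section Translation

variable {V : Type*}

lemma isCutVertex_iff [Finite V] {G : SimpleGraph V} [Nontrivial V] (hG : G.Connected) (x : V) :
    IsCutVertex G x ↔ ¬ ConnectedOn G (Set.univ \ {x}) := by
  have h1 : Nat.card G.ConnectedComponent = 1 := by
    have := hG.nonempty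
    have := hG.preconnected.subsingleton_connectedComponent
    exact Nat.card_eq_one_iff_unique.2 ⟨this, ⟨G.connectedComponentMk hG.nonempty.some⟩⟩
  obtain ⟨y, hy⟩ := exists_ne x
  have : Nonempty ({x}ᶜ : Set V) := ⟨⟨y, hy⟩⟩
  unfold IsCutVertex
  rw [h1, ← Set.compl_eq_univ_sdiff, ← connected_induce_iff, Finite.one_lt_card_iff_nontrivial,
    ← not_subsingleton_iff_nontrivial, not_iff_not, SimpleGraph.connected_iff,
    and_iff_left this]
  exact ⟨fun h a b => SimpleGraph.ConnectedComponent.exact (Subsingleton.elim _ _),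
    fun h => h.subsingleton_connectedComponent⟩

lemma isTwoConnected_iff [Finite V] (G : SimpleGraph V) :
    IsTwoConnected G ↔ Biconnected G Set.univ := by
  unfold IsTwoConnected Biconnected
  rw [← connected_iff_connectedOn, Set.nontrivial_univ_iff]
  constructor
  · rintro ⟨h1, h2, h3⟩
    exact ⟨h2, h1, fun x _ => by simpa [isCutVertex_iff h1] using h3 x⟩
  · rintro ⟨h1, h2, h3⟩
    exact ⟨h2, h1, fun x => by simpa [isCutVertex_iff h2] using h3 x trivial⟩

lemma connectedOn_image_iff {V' : Type*} {H : SimpleGraph V} {H' : SimpleGraph V'} (f : H ↪g H')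
    (S : Set V) : ConnectedOn H' (f '' S) ↔ ConnectedOn H S := by
  have hf := f.injective
  constructor
  · rintro ⟨h1, h2⟩
    refine ⟨h1.of_image, fun C hC hCl => hf.image_injective (h2 _ (hC.image f)
      ⟨Set.image_mono hCl.1, ?_⟩)⟩
    rintro _ ⟨a, ha, rfl⟩ _ ⟨b, hb, rfl⟩ hab
    exact ⟨b, hCl.2 a ha b hb (f.map_rel_iff.1 hab), rfl⟩
  · rintro ⟨h1, h2⟩
    refine ⟨h1.image f, fun C hC hCl => ?_⟩
    obtain ⟨D, hD, rfl⟩ := Set.subset_image_iff.1 hCl.1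
    rw [h2 D hC.of_image ⟨hD, fun a ha b hb hab => ?_⟩]
    exact hf.mem_set_image.1 (hCl.2 _ ⟨a, ha, rfl⟩ _ ⟨b, hb, rfl⟩ (f.map_rel_iff.2 hab))

variable {G : SimpleGraph V}

lemma Biconnected.mono {H H' : SimpleGraph V} {S : Set V}
    (hle : ∀ a ∈ S, ∀ b ∈ S, H.Adj a b → H'.Adj a b) (h : Biconnected H S) : Biconnected H' S :=
  ⟨h.1, h.2.1.mono hle, fun x hx =>
    (h.2.2 x hx).mono fun a ha b hb => hle a ha.1 b hb.1⟩

lemma isTwoConnected_coe_iff [Finite V] (N : G.Subgraph) :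
    IsTwoConnected N.coe ↔ Biconnected N.spanningCoe N.verts := by
  let f : N.coe ↪g N.spanningCoe := ⟨Function.Embedding.subtype _, Iff.rfl⟩
  have hf : ∀ T : Set N.verts, f '' T = Subtype.val '' T := fun _ => rfl
  rw [isTwoConnected_iff]
  unfold Biconnected
  refine and_congr ?_ (and_congr ?_ ?_)
  · rw [Set.nontrivial_univ_iff, Set.nontrivial_coe_sort]
  · rw [← connectedOn_image_iff f, hf, Set.image_univ, Subtype.range_val]
  · have key : ∀ x : N.verts, ConnectedOn N.coe (Set.univ \ {x}) ↔
        ConnectedOn N.spanningCoe (N.verts \ {x.1}) := by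
      intro x
      rw [← connectedOn_image_iff f, hf, Set.image_sdiff Subtype.val_injective, Set.image_univ,
        Subtype.range_val, Set.image_singleton]
    constructor
    · exact fun h x hx => (key ⟨x, hx⟩).1 (h _ trivial)
    · exact fun h x _ => (key x).2 (h x.1 x.2)

/-- Adding edges on the same vertices keeps a graph 2-connected, so blocks are induced and can be
handled as vertex sets. -/
lemma isBlock_iff [Finite V] (B : G.Subgraph) :
    IsBlock G B ↔
      Maximal (Biconnected G) B.verts ∧ B = (⊤ : G.Subgraph).induce B.verts := by
  have hsub : ∀ N : G.Subgraph, IsTwoConnected N.coe → Biconnected G N.verts := fun N hN =>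
    ((isTwoConnected_coe_iff N).1 hN).mono fun _ _ _ _ h => N.adj_sub h
  have hind : ∀ S : Set V, Biconnected G S →
      IsTwoConnected ((⊤ : G.Subgraph).induce S).coe := fun S hS =>
    (isTwoConnected_coe_iff _).2 (hS.mono fun a ha b hb hab => ⟨ha, hb, hab⟩)
  have hle : ∀ (N : G.Subgraph) (S : Set V), N.verts ⊆ S → N ≤ (⊤ : G.Subgraph).induce S :=
    fun N S h => ⟨h, fun a b hab => ⟨h (N.edge_vert hab), h (N.edge_vert hab.symm),
      N.adj_sub hab⟩⟩
  constructor
  · intro h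
    have hb := hsub B h.1
    exact ⟨⟨hb, fun T hT hBT => (h.2 (hind T hT) (hle B T hBT)).1⟩,
      (hle B _ subset_rfl).antisymm (h.2 (hind _ hb) (hle B _ subset_rfl))⟩
  · rintro ⟨h, hB⟩
    refine ⟨hB ▸ hind _ h.1, fun N hN hBN => ?_⟩
    rw [hB]
    exact hle N _ (h.2 (hsub N hN) hBN.1)

/-- The vertex sets of the leaf blocks of `G`. -/
def leafBlockSets (G : SimpleGraph V) : Set (Set V) :=
  {S | Maximal (Biconnected G) S ∧ {x ∈ S | IsCutVertex G x}.ncard = 1}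

lemma numLeafBlocks_eq [Finite V] (G : SimpleGraph V) :
    numLeafBlocks G = (leafBlockSets G).ncard := by
  refine Set.ncard_congr (fun B _ => B.verts) ?_ ?_ ?_
  · exact fun B hB => ⟨((isBlock_iff B).1 hB.1).1, hB.2⟩
  · intro B C hB hC h
    rw [((isBlock_iff B).1 hB.1).2, ((isBlock_iff C).1 hC.1).2]
    exact congrArg _ h
  · exact fun S hS => ⟨(⊤ : G.Subgraph).induce S, ⟨(isBlock_iff _).2 ⟨hS.1, rfl⟩, hS.2⟩, rfl⟩

lemma biconnected_pair {a b : V} (hab : G.Adj a b) : Biconnected G {a, b} := by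
  have hne := hab.ne
  refine ⟨Set.nontrivial_pair hne, ?_, ?_⟩
  · refine connectedOn_of_forall_notMem (x := a) (by simp) fun C hC ha => ?_
    refine Set.eq_empty_of_forall_notMem fun y hy => ?_
    rcases hC.1 hy with rfl | rfl
    · exact ha hy
    · exact ha (hC.2 _ hy a (by simp) hab.symm)
  · rintro x (rfl | rfl)
    · rw [Set.pair_sdiff_left hne]
      exact connectedOn_singleton _
    · rw [Set.pair_sdiff_right hne]
      exact connectedOn_singleton _

/-- A 2-connected set stays within one part of the graph without `x`. -/
lemma Biconnected.subset_insert {S C : Set V} {x : V} (hS : Biconnected G S)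
    (hC : AdjClosed G (Set.univ \ {x}) C) (hne : (C ∩ S).Nonempty) : S ⊆ insert x C := by
  have hconn : ConnectedOn G (S \ {x}) := by
    by_cases hx : x ∈ S
    · exact hS.2.2 x hx
    · rw [Set.sdiff_singleton_eq_self hx]
      exact hS.2.1
  obtain ⟨y, hyC, hyS⟩ := hne
  have := hconn.subset_of_adjClosed hC (Set.sdiff_subset_sdiff_left (Set.subset_univ _))
    ⟨y, hyC, hyS, (hC.1 hyC).2⟩
  intro z hz
  by_cases hzx : z = x
  · exact Or.inl hzx
  · exact Or.inr (this ⟨hz, hzx⟩)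

/-- At a cut-vertex the other vertices split into two parts. -/
lemma exists_parts [Finite V] [Nontrivial V] (hG : G.Connected) {x : V} (hx : IsCutVertex G x) :
    ∃ C D : Set V, C.Nonempty ∧ D.Nonempty ∧ AdjClosed G (Set.univ \ {x}) C ∧
      AdjClosed G (Set.univ \ {x}) D ∧ Disjoint C D := by
  rw [isCutVertex_iff hG] at hx
  obtain ⟨y, hy⟩ := exists_ne x
  by_contra! hcon
  refine hx ⟨⟨y, trivial, hy⟩, fun C hC hCl => ?_⟩
  by_contra hCne
  refine hcon C _ hC ?_ hCl hCl.compl Set.disjoint_sdiff_right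
  rw [Set.nonempty_iff_ne_empty]
  exact fun h => hCne (hCl.1.antisymm (Set.sdiff_eq_empty.1 h))

lemma exists_isBlock [Finite V] {a b : V} (hab : G.Adj a b) :
    ∃ B : G.Subgraph, IsBlock G B ∧ a ∈ B.verts ∧ b ∈ B.verts := by
  obtain ⟨S, hS, hmax⟩ := exists_maximal_ge_of_wellFoundedGT (Biconnected G) {a, b}
    (biconnected_pair hab)
  exact ⟨(⊤ : G.Subgraph).induce S, (isBlock_iff _).2 ⟨hmax, rfl⟩, hS (by simp), hS (by simp)⟩

lemma numLeaves_eq_numLeafBlocks [Finite V] [Nontrivial V] (hG : G.Connected) :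
    numLeaves G = numLeafBlocks G := by
  have hinl : ∀ B : {B : G.Subgraph // IsBlock G B},
      ((blockCutpointGraph G).neighborSet (Sum.inl B)).ncard =
        {x ∈ B.1.verts | IsCutVertex G x}.ncard := by
    intro B
    symm
    refine Set.ncard_congr (fun x hx => Sum.inr ⟨x, hx.2⟩) (fun x hx => hx.1) ?_ ?_
    · intro x y hx hy h
      exact congrArg Subtype.val (Sum.inr_injective h)
    · rintro (C | x) h
      · exact h.elim
      · exact ⟨x.1, ⟨h, x.2⟩, rfl⟩
  symm
  refine Set.ncard_congr (fun B hB => Sum.inl ⟨B, hB.1⟩) ?_ ?_ ?_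
  · exact fun B hB => (hinl ⟨B, hB.1⟩).trans hB.2
  · intro B C hB hC h
    exact congrArg Subtype.val (Sum.inl_injective h)
  · rintro (B | x) h
    · exact ⟨B.1, ⟨B.2, (hinl B).symm.trans h⟩, rfl⟩
    -- A cut-vertex is no leaf: edges from it into two different parts lie in different blocks.
    · exfalso
      obtain ⟨C, D, hC, hD, hCl, hDl, hdisj⟩ := exists_parts hG x.2
      have hconn := (connected_iff_connectedOn G).1 hG
      obtain ⟨c, hcC, hxc, -⟩ := hconn.inter_neighborSet_nonempty (Set.mem_univ x.1) hC hCl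
      obtain ⟨d, hdD, hxd, -⟩ := hconn.inter_neighborSet_nonempty (Set.mem_univ x.1) hD hDl
      obtain ⟨B, hB, hxB, hcB⟩ := exists_isBlock hxc
      obtain ⟨B', hB', hxB', hdB'⟩ := exists_isBlock hxd
      obtain ⟨a, ha⟩ := Set.ncard_eq_one.1 h
      have h1 : Sum.inl ⟨B, hB⟩ ∈ (blockCutpointGraph G).neighborSet (Sum.inr x) := hxB
      have h2 : Sum.inl ⟨B', hB'⟩ ∈ (blockCutpointGraph G).neighborSet (Sum.inr x) := hxB'
      rw [ha] at h1 h2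
      have hBB : B = B' := congrArg Subtype.val (Sum.inl_injective (h1.trans h2.symm))
      subst hBB
      have := ((isBlock_iff B).1 hB).1.1.subset_insert hCl ⟨c, hcC, hcB⟩ hdB'
      rcases this with rfl | h
      · exact (hDl.1 hdD).2 rfl
      · exact Set.disjoint_left.1 hdisj h hdD

end Translation

/-! ### Leaf blocks and the sets meeting all parts -/

lemma connectedOn_of_sdiff_singleton {V : Type*} {G : SimpleGraph V} {S : Set V} {y z : V}
    (h : ConnectedOn G (S \ {y})) (hz : z ∈ S) (hyz : G.Adj y z) : ConnectedOn G S := by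
  have hzS : z ∈ S \ {y} := ⟨hz, fun e => hyz.ne e.symm⟩
  refine connectedOn_of_forall_notMem hz fun C hC hzC => ?_
  by_contra hne
  have hyC : y ∉ C → False := fun hyC => hzC <| (h.2 C (Set.nonempty_iff_ne_empty.2 hne)
    ⟨fun x hx => ⟨hC.1 hx, fun e => hyC (e ▸ hx)⟩,
      fun a ha b hb => hC.2 a ha b hb.1⟩).ge hzS
  exact hzC (hC.2 y (by_contra hyC) z hz hyz)

section LeafBlocks

variable {V : Type*} [Finite V] {G : SimpleGraph V}

/-- A block contains the neighbours of its non-cut-vertices: otherwise a minimal connected set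
outside it with two attachments would enlarge it. -/
lemma mem_of_adj_of_maximal_biconnected {B : Set V} (hB : Maximal (Biconnected G) B) {v w : V}
    (hv : v ∈ B) (hcut : ConnectedOn G (Set.univ \ {v})) (hvw : G.Adj v w) : w ∈ B := by
  by_contra hw
  obtain ⟨hBn, hBc, hBd⟩ := hB.1
  obtain ⟨S₀, hS₀, hwS₀, hS₀c⟩ := exists_component G (W := Bᶜ) hw
  have hstart : w ∈ S₀ ∧ S₀ ⊆ Bᶜ ∧ ConnectedOn G S₀ ∧
      ∃ s ∈ S₀, ∃ b ∈ B \ {v}, G.Adj s b := by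
    refine ⟨hwS₀, hS₀.1, hS₀c, ?_⟩
    by_contra! hno
    -- Without a second attachment, `S₀` would be a part of `G - v` avoiding the rest of `B`.
    have hEq : S₀ = Set.univ \ {v} := by
      refine hcut.2 S₀ ⟨w, hwS₀⟩ ⟨fun x hx => ⟨trivial, fun e => hS₀.1 hx (e ▸ hv)⟩,
        fun a ha b hb hab => ?_⟩
      by_cases hbB : b ∈ B
      · exact (hno a ha b ⟨hbB, hb.2⟩ hab).elim
      · exact hS₀.2 a ha b hbB hab
    obtain ⟨b, hb, hbv⟩ := hBn.exists_ne v
    exact hS₀.1 (hEq.ge (show b ∈ Set.univ \ {v} from ⟨trivial, hbv⟩)) hb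
  obtain ⟨S, ⟨hwS, hSB, hSc, s, hs, b, hb, hsb⟩, hmin⟩ :=
    exists_minimal_of_wellFoundedLT (fun S : Set V => w ∈ S ∧ S ⊆ Bᶜ ∧ ConnectedOn G S ∧
      ∃ s ∈ S, ∃ b ∈ B \ {v}, G.Adj s b) ⟨S₀, hstart⟩
  have hBy : ∀ y, ConnectedOn G (B \ {y}) := by
    intro y
    by_cases hy : y ∈ B
    · exact hBd y hy
    · rwa [Set.sdiff_singleton_eq_self hy]
  -- No part of `(B ∪ S) \ {y}` avoids `B`. If `y ∈ S`, such a part could be cut off from `S`,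
  -- against minimality; if `y ∉ S`, it is all of `S`, and one of the attachments `v`, `b` survives.
  have key : ∀ y D, AdjClosed G ((B ∪ S) \ {y}) D → (D ∩ (B \ {y})) = ∅ → D = ∅ := by
    intro y D hD hDB
    by_contra hne
    rw [← ne_eq, ← Set.nonempty_iff_ne_empty] at hne
    have hDB' : ∀ d ∈ D, d ∉ B := fun d hd hdB =>
      Set.eq_empty_iff_forall_notMem.1 hDB d ⟨hd, hdB, (hD.1 hd).2⟩
    have hDS : D ⊆ S := fun d hd => (hD.1 hd).1.resolve_left (hDB' d hd)
    have hnadj : ∀ d ∈ D, ∀ z ∈ B, z ≠ y → ¬ G.Adj d z := fun d hd z hz hzy hdz =>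
      hDB' z (hD.2 d hd z ⟨Or.inl hz, hzy⟩ hdz) hz
    by_cases hyS : y ∈ S
    · have hyB : ∀ z ∈ B, z ≠ y := fun z hz e => hSB hyS (e ▸ hz)
      have hwD : w ∉ D := fun h => hnadj w h v hv (hyB v hv) hvw.symm
      have hsD : s ∉ D := fun h => hnadj s h b hb.1 (hyB b hb.1) hsb
      have hyD : y ∉ D := fun h => (hD.1 h).2 rfl
      have hconn : ConnectedOn G (S \ D) := by
        refine connectedOn_of_forall_notMem (x := y) ⟨hyS, hyD⟩ fun F hF hyF => ?_
        by_contra hFne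
        have : F = S := hSc.2 F (Set.nonempty_iff_ne_empty.2 hFne)
          ⟨hF.1.trans Set.sdiff_subset, fun a ha c hc hac => by
            by_cases hcD : c ∈ D
            · exact ((hF.1 ha).2 (hD.2 c hcD a
                ⟨Or.inr (hF.1 ha).1, fun e => hyF (e ▸ ha)⟩ hac.symm)).elim
            · exact hF.2 a ha c ⟨hc, hcD⟩ hac⟩
        exact hyF (this ▸ hyS)
      have hle := hmin (y := S \ D) ⟨⟨hwS, hwD⟩,
        Set.sdiff_subset.trans hSB, hconn, s, ⟨hs, hsD⟩, b, hb, hsb⟩ Set.sdiff_subset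
      obtain ⟨d, hd⟩ := hne
      exact (hle (hDS hd)).2 hd
    · have hDeq : D = S := hSc.2 D hne ⟨hDS, fun a ha c hc hac =>
        hD.2 a ha c ⟨Or.inr hc, fun e => hyS (e ▸ hc)⟩ hac⟩
      subst hDeq
      by_cases hyv : v = y
      · subst hyv
        exact hnadj s hs b hb.1 hb.2 hsb
      · exact hnadj w hwS v hv hyv hvw.symm
  have hconn : ∀ y, ConnectedOn G ((B ∪ S) \ {y}) := by
    intro y
    refine ⟨(hBy y).1.mono (Set.sdiff_subset_sdiff_left Set.subset_union_left),
      fun D hD hDl => ?_⟩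
    have h1 : (D ∩ (B \ {y})).Nonempty := by
      by_contra h
      exact hD.ne_empty (key y D hDl (Set.not_nonempty_iff_eq_empty.1 h))
    have h2 := (hBy y).subset_of_adjClosed hDl
      (Set.sdiff_subset_sdiff_left Set.subset_union_left) h1
    have h3 := key y _ hDl.compl
      (Set.eq_empty_of_forall_notMem fun z hz => hz.1.2 (h2 hz.2))
    exact hDl.1.antisymm (Set.sdiff_eq_empty.1 h3)
  have hBS : Biconnected G (B ∪ S) :=
     ⟨hBn.mono Set.subset_union_left,
      connectedOn_of_sdiff_singleton (hconn v) (Or.inr hwS) hvw, fun x _ => hconn x⟩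
  exact hw (hB.2 hBS Set.subset_union_left (Or.inr hwS))

/-- Non-cut-vertices have all their neighbours in the block, so an edge can leave them only to the
single cut-vertex `c`. -/
lemma exists_adjClosed_of_mem_leafBlockSets [Nontrivial V] (hG : G.Connected) {B : Set V}
    (hB : B ∈ leafBlockSets G) : ∃ c ∈ B, {y ∈ B | ¬ IsCutVertex G y}.Nonempty ∧
      AdjClosed G (Set.univ \ {c}) {y ∈ B | ¬ IsCutVertex G y} := by
  obtain ⟨hmax, hcard⟩ := hB
  obtain ⟨c, hc⟩ := Set.ncard_eq_one.1 hcard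
  have hcB : c ∈ {x ∈ B | IsCutVertex G x} := hc.symm.subset rfl
  have hiff : ∀ y ∈ B, y ≠ c → ¬ IsCutVertex G y := fun y hy hyc h => hyc (hc.subset ⟨hy, h⟩)
  obtain ⟨y, hy, hyc⟩ := hmax.1.1.exists_ne c
  refine ⟨c, hcB.1, ⟨y, hy, hiff y hy hyc⟩,
    fun a ha => ⟨trivial, fun e => ha.2 (e.symm ▸ hcB.2)⟩, fun a ha b hb hab => ?_⟩
  have hbB : b ∈ B := by
    refine mem_of_adj_of_maximal_biconnected hmax ha.1 ?_ hab
    by_contra hcut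
    exact ha.2 ((isCutVertex_iff hG a).2 hcut)
  exact ⟨hbB, hiff b hbB hb.2⟩

/-- Beyond every cut-vertex lies a leaf block. -/
lemma exists_leafBlock [Nontrivial V] (hG : G.Connected) {x : V} (hx : IsCutVertex G x)
    {C : Set V} (hC : C.Nonempty) (hCl : AdjClosed G (Set.univ \ {x}) C) :
    ∃ B ∈ leafBlockSets G, {y ∈ B | ¬ IsCutVertex G y} ⊆ C := by
  have hconn := (connected_iff_connectedOn G).1 hG
  -- With `D` a minimal part over all cut-vertices, `insert c D` will be the leaf block.
  obtain ⟨D, hDC, ⟨⟨hD, c, hc, hDl⟩, hmin⟩⟩ := exists_minimal_le_of_wellFoundedLT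
    (fun D : Set V => D.Nonempty ∧ ∃ c, IsCutVertex G c ∧ AdjClosed G (Set.univ \ {c}) D)
    C ⟨hC, x, hx, hCl⟩
  have hcD : c ∉ D := fun h => (hDl.1 h).2 rfl
  have hnocut : ∀ y ∈ D, ¬ IsCutVertex G y := by
    intro y hy hcut
    obtain ⟨E, E', hE, hE', hEl, hEl', hdisj⟩ := exists_parts hG hcut
    -- A part at `y` avoiding `c` would lie in `D` and miss `y`, against minimality; but two
    -- disjoint parts cannot both contain `c`.
    have main : ∀ F : Set V, F.Nonempty → AdjClosed G (Set.univ \ {y}) F → c ∈ F := by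
      intro F hF hFl
      by_contra hcF
      have hyF : y ∉ F := fun h => (hFl.1 h).2 rfl
      have hFD : F ⊆ D := by
        by_contra hFD
        have : F \ D = Set.univ := hconn.2 (F \ D) (Set.not_subset.1 hFD)
          ⟨Set.subset_univ _, fun a ha b _ hab => by
            have hac : a ∈ Set.univ \ {c} := ⟨trivial, fun e => hcF (e ▸ ha.1)⟩
            have hbD : b ∉ D := fun hbD => ha.2 (hDl.2 b hbD a hac hab.symm)
            exact ⟨hFl.2 a ha.1 b ⟨trivial, fun e => hbD (e ▸ hy)⟩ hab, hbD⟩⟩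
        exact hyF (this.ge (Set.mem_univ y)).1
      exact hyF (hmin ⟨hF, y, hcut, hFl⟩ hFD hy)
    exact Set.disjoint_left.1 hdisj (main E hE hEl) (main E' hE' hEl')
  have hDc : insert c D \ {c} = D := by
    rw [Set.insert_sdiff_of_mem _ (Set.mem_singleton c), Set.sdiff_singleton_eq_self hcD]
  have hDconn : ConnectedOn G D := ⟨hD, fun F hF hFl => hFl.1.antisymm <|
    hmin ⟨hF, c, hc, hFl.1.trans hDl.1, fun a ha b hb hab =>
      hFl.2 a ha b (hDl.2 a (hFl.1 ha) b hb hab) hab⟩ hFl.1⟩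
  have hbic : Biconnected G (insert c D) := by
    refine ⟨?_, ?_, ?_⟩
    · obtain ⟨d, hd⟩ := hD
      exact ⟨c, Or.inl rfl, d, Or.inr hd, fun e => hcD (e ▸ hd)⟩
    · obtain ⟨d, hd, hcd, -⟩ := hconn.inter_neighborSet_nonempty (Set.mem_univ c) hD hDl
      exact connectedOn_of_sdiff_singleton (hDc.symm ▸ hDconn) (Or.inr hd) hcd
    · rintro y (rfl | hy)
      · rwa [hDc]
      · have hy' : ConnectedOn G (Set.univ \ {y}) := by
          by_contra h
          exact hnocut y hy ((isCutVertex_iff hG y).2 h)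
        have hcy : c ≠ y := fun e => hcD (e ▸ hy)
        refine connectedOn_of_forall_notMem (x := c) ⟨Or.inl rfl, hcy⟩ fun F hF hcF => ?_
        by_contra hne
        have hFD : F ⊆ D := fun z hz => (hF.1 hz).1.resolve_left fun e => hcF (e ▸ hz)
        have := hy'.2 F (Set.nonempty_iff_ne_empty.2 hne)
          ⟨hF.1.trans (Set.sdiff_subset_sdiff_left (Set.subset_univ _)), fun a ha b hb hab =>
            hF.2 a ha b ⟨by
              by_cases hbc : b = c
              · exact Or.inl hbc
              · exact Or.inr (hDl.2 a (hFD ha) b ⟨trivial, hbc⟩ hab), hb.2⟩ hab⟩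
        exact hcF (this.ge (show c ∈ Set.univ \ {y} from ⟨trivial, hcy⟩))
  have hmaxB : Maximal (Biconnected G) (insert c D) :=
    ⟨hbic, fun T hT hle => hT.subset_insert hDl (hD.mono fun z hz => ⟨hz, hle (Or.inr hz)⟩)⟩
  refine ⟨insert c D, ⟨hmaxB, Set.ncard_eq_one.2 ⟨c, ?_⟩⟩, ?_⟩
  · ext z
    constructor
    · rintro ⟨rfl | hz, hcut⟩
      · rfl
      · exact (hnocut z hz hcut).elim
    · rintro rfl
      exact ⟨Or.inl rfl, hc⟩
  · rintro z ⟨rfl | hz, hcut⟩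
    · exact (hcut hc).elim
    · exact hDC hz

lemma exists_two_leafBlocks [Nontrivial V] (hG : G.Connected) {x : V} (hx : IsCutVertex G x) :
    ∃ B ∈ leafBlockSets G, ∃ B' ∈ leafBlockSets G,
      Disjoint {y ∈ B | ¬ IsCutVertex G y} {y ∈ B' | ¬ IsCutVertex G y} := by
  obtain ⟨C, D, hC, hD, hCl, hDl, hdisj⟩ := exists_parts hG hx
  obtain ⟨B, hB, hBC⟩ := exists_leafBlock hG hx hC hCl
  obtain ⟨B', hB', hBD⟩ := exists_leafBlock hG hx hD hDl
  exact ⟨B, hB, B', hB', hdisj.mono hBC hBD⟩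

lemma two_le_ncard_leafBlockSets [Nontrivial V] (hG : G.Connected) {x : V}
    (hx : IsCutVertex G x) : 2 ≤ (leafBlockSets G).ncard := by
  obtain ⟨B, hB, B', hB', hdisj⟩ := exists_two_leafBlocks hG hx
  refine (Set.one_lt_ncard_iff).2 ⟨B, B', hB, hB', ?_⟩
  rintro rfl
  obtain ⟨c, -, hne, -⟩ := exists_adjClosed_of_mem_leafBlockSets hG hB
  exact hne.ne_empty (disjoint_self.1 hdisj)

/-- `U` meets the non-cut-vertices of each leaf block, and these sets are disjoint for distinct leaf
blocks. -/
lemma MeetsAllParts.ncard_leafBlockSets_le [Nontrivial V] (hG : G.Connected) {U : Set V}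
    (hU : MeetsAllParts G Set.univ U) : (leafBlockSets G).ncard ≤ U.ncard := by
  have key : ∀ B ∈ leafBlockSets G, ∃ y ∈ U, y ∈ B ∧ ¬ IsCutVertex G y := by
    intro B hB
    obtain ⟨c, -, hne, hcl⟩ := exists_adjClosed_of_mem_leafBlockSets hG hB
    obtain ⟨y, hy, hyU⟩ := hU c trivial _ hne hcl
    exact ⟨y, hyU, hy⟩
  choose! f hfU hf using key
  refine Set.ncard_le_ncard_of_injOn f hfU fun B hB B' hB' heq => ?_
  obtain ⟨c, hcB, -, hcl⟩ := exists_adjClosed_of_mem_leafBlockSets hG hB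
  have hsub : B' ⊆ B := (hB'.1.1.subset_insert hcl ⟨f B, hf B hB, heq ▸ (hf B' hB').1⟩).trans
    (Set.insert_subset hcB fun y hy => hy.1)
  exact (hB'.1.2 hB.1.1 hsub).antisymm hsub

/-- Take one non-cut-vertex from each leaf block. For the deletion of a non-cut-vertex, two distinct
chosen points suffice, whence the need for two leaf blocks. -/
lemma exists_meetsAllParts [Nontrivial V] (hG : G.Connected) {x₀ : V}
    (hx₀ : IsCutVertex G x₀) :
    ∃ U : Set V, U.ncard ≤ (leafBlockSets G).ncard ∧ MeetsAllParts G Set.univ U := by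
  have key : ∀ B ∈ leafBlockSets G, ∃ y, y ∈ B ∧ ¬ IsCutVertex G y := by
    intro B hB
    obtain ⟨-, -, hne, -⟩ := exists_adjClosed_of_mem_leafBlockSets hG hB
    exact hne
  choose! f hf using key
  refine ⟨f '' leafBlockSets G, Set.ncard_image_le, fun x _ C hC hCl => ?_⟩
  by_cases hx : IsCutVertex G x
  · obtain ⟨B, hB, hBC⟩ := exists_leafBlock hG hx hC hCl
    exact ⟨f B, hBC (hf B hB), B, hB, rfl⟩
  · obtain ⟨B, hB, B', hB', hdisj⟩ := exists_two_leafBlocks hG hx₀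
    rw [isCutVertex_iff hG, not_not] at hx
    have hCeq := hx.2 C hC hCl
    have hne : f B ≠ f B' := fun e => Set.disjoint_left.1 hdisj (hf B hB) (e ▸ hf B' hB')
    by_cases h : f B = x
    · exact ⟨f B', hCeq.ge (show f B' ∈ Set.univ \ {x} from
        ⟨trivial, fun e => hne (h.trans e.symm)⟩), B', hB', rfl⟩
    · exact ⟨f B, hCeq.ge (show f B ∈ Set.univ \ {x} from ⟨trivial, h⟩), B, hB, rfl⟩

end LeafBlocks

/-! ### The two cases of the theorem -/

section Main

variable {V : Type*} {G : SimpleGraph V}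

lemma Biconnected.meetsAllParts (hG : Biconnected G Set.univ) {U : Set V} (hU : U.Nontrivial) :
    MeetsAllParts G Set.univ U := by
  intro x _ C hC hCl
  obtain ⟨y, hy, hyx⟩ := hU.exists_ne x
  exact ⟨y, ((hG.2.2 x trivial).2 C hC hCl).ge (show y ∈ Set.univ \ {x} from ⟨trivial, hyx⟩), hy⟩

/-- Exchange the two deletions: `G - y` is connected, so each part left by removing `u` from it
touches `u`. -/
lemma Biconnected.meetsAllParts_neighborSet (hG : Biconnected G Set.univ) (u : V) :
    MeetsAllParts G (Set.univ \ {u}) (G.neighborSet u) := by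
  intro y hy C hC hCl
  have huy : u ∈ Set.univ \ {y} := ⟨trivial, fun e => hy.2 e.symm⟩
  rw [sdiff_sdiff_comm] at hCl
  exact ((hG.2.2 y trivial).inter_neighborSet_nonempty huy hC hCl).mono
    (Set.inter_subset_inter_right _ Set.inter_subset_left)

variable [Fintype V] [Nontrivial V]

theorem els_zero_neg (hG : Biconnected G Set.univ) : els G 0 < 0 := by
  obtain ⟨u, hu⟩ := hG.1.nonempty
  have hconn := hG.2.2 u hu
  obtain ⟨y, -, hy, -⟩ := hG.2.1.inter_neighborSet_nonempty hu hconn.1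
    ⟨subset_rfl, fun _ _ _ hb _ => hb⟩
  rw [els_zero_eq hG.2.1 u, neg_lt_zero]
  exact (coverSum_nonneg_and_pos_iff hconn (fun x hx => ⟨trivial, fun e => hx.ne e.symm⟩)
    ⟨y, hy⟩).2.2 (hG.meetsAllParts_neighborSet u)

theorem els_one_eq_zero (hG : ConnectedOn G Set.univ) : els G 1 = 0 := by
  obtain ⟨h0, hpos⟩ := els_nonneg_and_pos_iff hG one_ne_zero
  refine le_antisymm (not_lt.1 fun h => ?_) h0
  obtain ⟨U, hU, hmeet⟩ := hpos.1 h
  obtain ⟨x, hx⟩ := (Set.ncard_le_one_iff_subset_singleton (s := U)).1 hU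
  obtain ⟨y, hy⟩ := exists_ne x
  exact not_meetsAllParts_singleton (W := Set.univ) ⟨y, trivial, hy⟩ trivial (hmeet.mono hx)

theorem els_pos (hG : Biconnected G Set.univ) {k : ℕ} (hk : 2 ≤ k) : 0 < els G k := by
  obtain ⟨a, b, hab⟩ := exists_pair_ne V
  refine (els_nonneg_and_pos_iff hG.2.1 (by omega)).2.2 ⟨{a, b}, ?_,
    hG.meetsAllParts (Set.nontrivial_pair hab)⟩
  rwa [Set.ncard_pair hab]

theorem els_ne_zero_iff (hG : G.Connected) {u : V} (hu : IsCutVertex G u) (k : ℕ) :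
    els G k ≠ 0 ↔ (leafBlockSets G).ncard ≤ k := by
  have hconn := (connected_iff_connectedOn G).1 hG
  rcases eq_or_ne k 0 with rfl | hk
  · have h2 := two_le_ncard_leafBlockSets hG hu
    refine iff_of_false (not_not.2 ?_) (by omega)
    obtain ⟨y, hy⟩ := exists_ne u
    -- Expanding at the cut-vertex `u` leaves a disconnected `W`, whose parts all contain neighbours
    -- of `u`.
    rw [els_zero_eq hconn u, coverSum_eq_zero_of_not_connectedOn ((isCutVertex_iff hG u).1 hu)
      ⟨y, trivial, hy⟩ fun C hC hCl => ?_, neg_zero]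
    exact (hconn.inter_neighborSet_nonempty trivial hC hCl).mono
      (Set.inter_subset_inter_right _ Set.inter_subset_left)
  · obtain ⟨h0, hpos⟩ := els_nonneg_and_pos_iff hconn hk
    rw [← h0.lt_iff_ne', hpos]
    constructor
    · rintro ⟨U, hUk, hU⟩
      exact (hU.ncard_leafBlockSets_le hG).trans hUk
    · intro hk
      obtain ⟨U, hUc, hU⟩ := exists_meetsAllParts hG hu
      exact ⟨U, hUc.trans hk, hU⟩

end Main

end Elser

theorem theorem2 {V : Type*} [Fintype V] [Nontrivial V] (G : SimpleGraph V)
    (hG : G.Connected) :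
    (Elser.IsTwoConnected G →
      Elser.els G 0 < 0 ∧ Elser.els G 1 = 0 ∧ ∀ k : ℕ, 2 ≤ k → 0 < Elser.els G k) ∧
    (¬ Elser.IsTwoConnected G →
      2 ≤ Elser.numLeaves G ∧
      Elser.numLeaves G = Elser.numLeafBlocks G ∧
      ∀ k : ℕ, Elser.els G k ≠ 0 ↔ Elser.numLeaves G ≤ k) := by
  constructor
  · intro h
    rw [Elser.isTwoConnected_iff] at h
    exact ⟨Elser.els_zero_neg h, Elser.els_one_eq_zero h.2.1, fun k hk => Elser.els_pos h hk⟩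
  · intro h
    obtain ⟨u, hu⟩ : ∃ u, Elser.IsCutVertex G u := by
      by_contra! hno
      exact h ⟨hG, inferInstance, hno⟩
    have hl := Elser.numLeaves_eq_numLeafBlocks hG
    rw [hl, Elser.numLeafBlocks_eq]
    exact ⟨Elser.two_le_ncard_leafBlockSets hG hu, rfl, Elser.els_ne_zero_iff hG hu⟩
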